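/- Let $k$ be a field, let $n\ge 0$, and let $S$ be a $k$-subalgebra of the polynomial ring $k[x_1,\dots,x_n]$ generated by a set of monomials, not necessarily finite. Grade $S=\bigoplus_{i\ge 0}S_i$ by total degree, i.e. $S_i=S\cap k[x_1,\dots,x_n]_i$, and let $P_S(t)=\sum_{i\ge 0}(\dim_k S_i)\,t^i$ be its Poincaré series. Then $S$ is a Hilbert-Serre ring: it is an $\mathbb N$-graded ring with $S_0=k$, all $\dim_k S_i$ are finite, $P_S$ has radius of convergence at least $1$, and there is $d\in\mathbb N$ such that $(1-t)^dP_S(t)$ has a finite limit as $t\to 1$ from the left. Moreover, if $d(S)$ denotes the least such $d$, then $$\dim(S)=\operatorname{trdeg}_k(S)=\operatorname{GKdim}_k(S)=d(S).$$ Here $\dim(S)$ is the Krull dimension, $\operatorname{trdeg}_k(S)$ is the transcendence degree of $S$ over $k$, and $$\operatorname{GKdim}_k(S)=\sup_V\limsup_{m\to\infty}\frac{\log\dim_k(k+V+V^2+\cdots+V^m)}{\log m},$$ where $V$ runs over the finite-dimensional $k$-subspaces of $S$ and $V^i$ is the $k$-span of all products of $i$ elements of $V$. -/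

import Mathlib

open Filter Topology

noncomputable section

/-- `k + V + V ^ 2 + ⋯ + V ^ n`, where `V ^ i` is the `k`-span of all products of `i` elements of
`V` (and `V ^ 0` is the image of `k`). -/
def powerSum {k A : Type*} [Field k] [CommRing A] [Algebra k A]
    (V : Submodule k A) (n : ℕ) : Submodule k A :=
  ∑ i ∈ Finset.range (n + 1), V ^ i

/-- The Gelfand-Kirillov dimension of a commutative `k`-algebra, as an extended real number:
the supremum, over the finite-dimensional subspaces `V`, of
`limsup_{n → ∞} log (dim_k (k + V + ⋯ + V ^ n)) / log n`. -/
def gkDim (k A : Type*) [Field k] [CommRing A] [Algebra k A] : EReal :=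
  ⨆ V : {V : Submodule k A // FiniteDimensional k V},
    limsup (fun n : ℕ =>
      ((Real.log (Module.finrank k (powerSum V.1 n)) / Real.log n : ℝ) : EReal)) atTop

/-- The Poincaré series `∑ (dim_k R_n) t ^ n` of the family `R_n = 𝒜 n`, as a function of a real
variable. -/
def poincareSeries {k A : Type*} [Field k] [CommRing A] [Algebra k A]
    (𝒜 : ℕ → Submodule k A) (t : ℝ) : ℝ :=
  ∑' n : ℕ, (Module.finrank k (𝒜 n) : ℝ) * t ^ n

/-- The radius of convergence of the Poincaré series. -/
def poincareRadius {k A : Type*} [Field k] [CommRing A] [Algebra k A]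
    (𝒜 : ℕ → Submodule k A) : ENNReal :=
  (FormalMultilinearSeries.ofScalars ℝ
    (fun n : ℕ => (Module.finrank k (𝒜 n) : ℝ))).radius

/-- The set of all natural numbers `d` such that `(1 - t) ^ d * P(t)` has a finite limit as `t`
tends to `1` from the left, where `P` is the Poincaré series. -/
def poleBounds {k A : Type*} [Field k] [CommRing A] [Algebra k A]
    (𝒜 : ℕ → Submodule k A) : Set ℕ :=
  {d : ℕ | ∃ L : ℝ, Tendsto (fun t : ℝ => (1 - t) ^ d * poincareSeries 𝒜 t) (𝓝[<] 1) (𝓝 L)}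

/-- `A`, with homogeneous components `𝒜 n`, is a Hilbert-Serre ring: an `ℕ`-graded ring with degree
zero part the field `k`, with finite-dimensional homogeneous components, whose Poincaré series
converges on the open unit disc and has a pole of finite order at `1`.
The radius of convergence is at most `1` as soon as infinitely many components are nonzero, so
`1 ≤ radius` says that it is `1`, except if `A` is finite-dimensional, where it is infinite. -/
structure IsHilbertSerre {k A : Type*} [Field k] [CommRing A] [Algebra k A]
    (𝒜 : ℕ → Submodule k A) : Prop where
  nontrivial : Nontrivial A
  gradedMonoid : SetLike.GradedMonoid 𝒜
  isInternal : DirectSum.IsInternal 𝒜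
  zero_eq : 𝒜 0 = 1
  finite : ∀ n, FiniteDimensional k (𝒜 n)
  one_le_radius : 1 ≤ poincareRadius 𝒜
  poleBounds_nonempty : (poleBounds 𝒜).Nonempty

/-- The Hilbert-Serre dimension: the least `d` for which `(1 - t) ^ d * P(t)` has a finite limit as
`t` tends to `1` from the left (meaningful for Hilbert-Serre rings). -/
def hilbertSerreDim {k A : Type*} [Field k] [CommRing A] [Algebra k A]
    (𝒜 : ℕ → Submodule k A) : ℕ :=
  sInf (poleBounds 𝒜)

/-- A subalgebra of the polynomial ring in `n` variables that is generated by a (finite or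
infinite) set of monomials. -/
def IsMonomialAlgebra {k : Type*} [Field k] {n : ℕ}
    (S : Subalgebra k (MvPolynomial (Fin n) k)) : Prop :=
  ∃ E : Set (Fin n →₀ ℕ), S = Algebra.adjoin k ((fun e => MvPolynomial.monomial e (1 : k)) '' E)

/-- The homogeneous components `S_i = S ∩ k[x_1, …, x_n]_i` of a subalgebra of the polynomial ring
with its standard grading, as subspaces of `S`. -/
def standardGrading {k : Type*} [Field k] {n : ℕ}
    (S : Subalgebra k (MvPolynomial (Fin n) k)) (i : ℕ) : Submodule k S :=
  (MvPolynomial.homogeneousSubmodule (Fin n) k i).comap S.val.toLinearMap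

end

/-! Let `M` be the monoid of exponents of monomials in `S`, and `r` the dimension of its real span;
`S` has the monomials of `M` as a basis, and all four invariants equal `r`.

The core is a count (`exists_tendsto_ncard_deg_le`): the elements of `M` of degree at most `N`
number `c * N ^ r` asymptotically, with `c > 0`. Scaled by `1 / N`, they are lattice points in the
bounded convex set `K` generated by `0` and the elements of `M` normalised to degree `1`.
Conversely, `K` is an increasing union of polytopes `K j` from finitely many elements, and up to a
fixed translation all lattice points of the cone over `K j` lie in `M` (`exists_conductor`). The
volumes of `K j` tend to that of `K`, so both bounds agree although `M` need not be finitely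
generated.

An Abelian theorem turns the count into `(1 - t) ^ r * P(t) → c * r! > 0`, so the pole has order
exactly `r`. As `V ^ m` lives in degrees at most `D * m`, the count also bounds GKdim by `r`.
Algebraically independent elements bound GKdim from below, so trdeg is at most `r`, and `r` linearly
independent exponents give equality in both. A chain of primes yields as many algebraically
independent elements as its length, so the Krull dimension is at most `r`; kernels of maps to group
algebras of quotients of `ℝ ^ n` form a chain of length `r`. -/

/-! ### Krull dimension and transcendence degree against algebraically independent families -/

theorem aeval_eq_eval₂_finSuccEquiv {k A : Type*} [CommRing k] [CommRing A] [Algebra k A] {l : ℕ}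
    (x : Fin (l + 1) → A) (F : MvPolynomial (Fin (l + 1)) k) :
    MvPolynomial.aeval x F = (MvPolynomial.finSuccEquiv k l F).eval₂
      (MvPolynomial.aeval fun i : Fin l => x i.succ : MvPolynomial (Fin l) k →ₐ[k] A).toRingHom
      (x 0) := by
  induction F using MvPolynomial.induction_on with
  | C a =>
    have h : MvPolynomial.finSuccEquiv k l (MvPolynomial.C a)
        = Polynomial.C (MvPolynomial.C a) := by
      simp [MvPolynomial.finSuccEquiv_apply]
    rw [h]
    simp
  | add p q hp hq => simp [hp, hq, Polynomial.eval₂_add]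
  | mul_X p i hp =>
    rw [map_mul, map_mul, hp, Polynomial.eval₂_mul, MvPolynomial.aeval_X]
    congr 1
    refine Fin.cases ?_ (fun j => ?_) i
    · rw [MvPolynomial.finSuccEquiv_X_zero, Polynomial.eval₂_X]
    · rw [MvPolynomial.finSuccEquiv_X_succ, Polynomial.eval₂_C]
      simp

/-- Elements `x i ∈ p (i + 1) \ p i` picked along a chain of primes satisfy no polynomial relation,
even modulo the smallest prime. -/
theorem eq_zero_of_aeval_mem_of_chain {k A : Type*} [Field k] [CommRing A] [Algebra k A] :
    ∀ (l : ℕ) (p : Fin (l + 1) → Ideal A) (_ : ∀ i, (p i).IsPrime)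
      (_ : ∀ i : Fin l, p i.castSucc ≤ p i.succ) (x : Fin l → A)
      (_ : ∀ i, x i ∈ p i.succ) (_ : ∀ i, x i ∉ p i.castSucc)
      (F : MvPolynomial (Fin l) k), MvPolynomial.aeval x F ∈ p 0 → F = 0 := by
  intro l
  induction l with
  | zero =>
    intro p hp _ x _ _ F hF
    obtain ⟨a, rfl⟩ := MvPolynomial.C_surjective (Fin 0) F
    rw [MvPolynomial.aeval_C] at hF
    by_contra h
    have ha : a ≠ 0 := fun h0 => h (by rw [h0, map_zero])
    exact (hp 0).ne_top (Ideal.eq_top_of_isUnit_mem _ hF ((IsUnit.mk0 a ha).map _))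
  | succ l ih =>
    intro p hp hle x hx hx' F hF
    rw [aeval_eq_eval₂_finSuccEquiv] at hF
    have ih' := ih (fun i => p i.succ) (fun i => hp _) (fun i => hle i.succ)
      (fun i => x i.succ) (fun i => hx i.succ) (fun i => hx' i.succ)
    -- Reducing modulo `p 1`, which contains `x 0`, leaves only the constant coefficient, which
    -- vanishes by `ih'`. Then `f = X * f.divX`, and as `x 0 ∉ p 0`, primality passes the hypothesis
    -- to `f.divX`, of smaller degree.
    have key : ∀ (N : ℕ) (f : Polynomial (MvPolynomial (Fin l) k)), f.natDegree < N →
        f.eval₂ (MvPolynomial.aeval fun i : Fin l => x i.succ :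
          MvPolynomial (Fin l) k →ₐ[k] A).toRingHom (x 0) ∈ p 0 → f = 0 := by
      intro N
      induction N with
      | zero => intro f hf; omega
      | succ N ihN =>
        intro f hdeg hf
        have hdecomp := Polynomial.X_mul_divX_add f
        have h0 : f.coeff 0 = 0 := by
          apply ih'
          have h1 := hle 0 hf
          rw [← hdecomp, Polynomial.eval₂_add, Polynomial.eval₂_mul, Polynomial.eval₂_X,
            Polynomial.eval₂_C] at h1
          have h2 := (Ideal.add_mem_iff_right _ (Ideal.mul_mem_right _ _ (hx 0))).1 h1
          exact h2
        rw [h0, map_zero, add_zero] at hdecomp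
        by_cases hd : f.natDegree = 0
        · rw [Polynomial.eq_C_of_natDegree_eq_zero hd, h0, map_zero]
        rw [← hdecomp, Polynomial.eval₂_mul, Polynomial.eval₂_X] at hf
        have h3 := ((hp 0).mem_or_mem hf).resolve_left (hx' 0)
        rw [← hdecomp, ihN f.divX (by rw [Polynomial.natDegree_divX_eq_natDegree_tsub_one]; omega)
          h3, mul_zero]
    have := key _ _ (Nat.lt_succ_self _) hF
    simpa using this

theorem exists_algebraicIndependent_of_ltSeries {k A : Type*} [Field k] [CommRing A] [Algebra k A]
    (c : LTSeries (PrimeSpectrum A)) : ∃ y : Fin c.length → A, AlgebraicIndependent k y := by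
  have h : ∀ i : Fin c.length, ∃ x, x ∈ (c i.succ).asIdeal ∧ x ∉ (c i.castSucc).asIdeal := by
    intro i
    have := c.step i
    exact SetLike.exists_of_lt ((PrimeSpectrum.asIdeal_lt_asIdeal _ _).2 this)
  choose x hx hx' using h
  refine ⟨x, ?_⟩
  rw [algebraicIndependent_iff]
  intro F hF
  refine eq_zero_of_aeval_mem_of_chain c.length (fun i => (c i).asIdeal) (fun i => (c i).isPrime)
    (fun i => ?_) x hx hx' F (by rw [hF]; exact zero_mem _)
  exact ((PrimeSpectrum.asIdeal_lt_asIdeal _ _).2 (c.step i)).le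

theorem ringKrullDim_le_of_forall_algebraicIndependent (k : Type*) {A : Type*} [Field k]
    [CommRing A] [Algebra k A] {r : ℕ}
    (h : ∀ (s : ℕ) (y : Fin s → A), AlgebraicIndependent k y → s ≤ r) :
    ringKrullDim A ≤ r := by
  refine iSup_le fun c => ?_
  obtain ⟨y, hy⟩ := exists_algebraicIndependent_of_ltSeries (k := k) c
  exact_mod_cast h _ y hy

theorem trdeg_le_of_forall_algebraicIndependent {k A : Type*} [Field k]
    [CommRing A] [Algebra k A] {r : ℕ}
    (h : ∀ (s : ℕ) (y : Fin s → A), AlgebraicIndependent k y → s ≤ r) :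
    Algebra.trdeg k A ≤ r := by
  refine ciSup_le' fun s => ?_
  by_contra hs
  rw [not_le] at hs
  have h1 : ((r + 1 : ℕ) : Cardinal) ≤ Cardinal.mk s.1 := by
    rw [Nat.cast_succ, ← Cardinal.succ_natCast]
    exact Order.succ_le_of_lt hs
  have h2 : Cardinal.lift.{_, 0} (Cardinal.mk (Fin (r + 1))) ≤ Cardinal.lift.{0} (Cardinal.mk s.1) := by
    simpa using h1
  obtain ⟨f⟩ := Cardinal.lift_mk_le'.1 h2
  have := h (r + 1) _ (s.2.comp f f.injective)
  omega

theorem le_trdeg_of_algebraicIndependent {k A : Type*} [Field k]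
    [CommRing A] [Algebra k A] {s : ℕ} {y : Fin s → A} (hy : AlgebraicIndependent k y) :
    (s : Cardinal) ≤ Algebra.trdeg k A := by
  have := hy.lift_cardinalMk_le_trdeg
  simpa using this

/-! ### Growth and Gelfand-Kirillov dimension -/

theorem powerSum_fg {k A : Type*} [Field k] [CommRing A] [Algebra k A]
    {V : Submodule k A} (hV : V.FG) (n : ℕ) : (powerSum V n).FG := by
  unfold powerSum
  induction n + 1 with
  | zero => simpa using Submodule.fg_bot
  | succ n ih =>
    rw [Finset.sum_range_succ]
    exact ih.sup (hV.pow n)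

theorem pow_le_powerSum {k A : Type*} [Field k] [CommRing A] [Algebra k A]
    (V : Submodule k A) {i n : ℕ} (h : i ≤ n) : V ^ i ≤ powerSum V n := by
  unfold powerSum
  exact Finset.single_le_sum (f := fun i => V ^ i) (fun _ _ => bot_le)
    (Finset.mem_range.2 (Nat.lt_succ_of_le h))

theorem powerSum_mono {k A : Type*} [Field k] [CommRing A] [Algebra k A]
    (V : Submodule k A) {m n : ℕ} (h : m ≤ n) : powerSum V m ≤ powerSum V n := by
  unfold powerSum
  exact Finset.sum_le_sum_of_subset (Finset.range_mono (by omega))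

theorem prod_pow_mem_pow_sum {k A ι : Type*} [Field k] [CommRing A] [Algebra k A]
    {V : Submodule k A} {y : ι → A} (hy : ∀ i, y i ∈ V) (a : ι → ℕ) (s : Finset ι) :
    ∏ i ∈ s, y i ^ a i ∈ V ^ ∑ i ∈ s, a i := by
  classical
  induction s using Finset.induction_on with
  | empty => simpa using (Submodule.one_le (P := (1 : Submodule k A))).1 le_rfl
  | insert i s hi ih =>
    rw [Finset.prod_insert hi, Finset.sum_insert hi, pow_add]
    exact Submodule.mul_mem_mul (Submodule.pow_mem_pow V (hy i) _) ih

theorem linearIndependent_prod_pow {k A : Type*} [Field k] [CommRing A] [Algebra k A] {s : ℕ}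
    {y : Fin s → A} (hy : AlgebraicIndependent k y) :
    LinearIndependent k fun a : Fin s →₀ ℕ => ∏ i, y i ^ a i := by
  have h := (MvPolynomial.basisMonomials (Fin s) k).linearIndependent.map'
    (MvPolynomial.aeval y).toLinearMap (LinearMap.ker_eq_bot.2 hy)
  convert! h using 2 with a
  simp [MvPolynomial.aeval_monomial, Finsupp.prod_fintype]

/-- The span of `s` algebraically independent elements has growth of order at least `s`. -/
theorem pow_le_finrank_powerSum {k A : Type*} [Field k] [CommRing A] [Algebra k A] {s : ℕ}
    {y : Fin s → A} (hy : AlgebraicIndependent k y) (m : ℕ) :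
    (m + 1) ^ s ≤ Module.finrank k (powerSum (Submodule.span k (Set.range y)) (s * m)) := by
  set V := Submodule.span k (Set.range y)
  have hfg : (powerSum V (s * m)).FG := powerSum_fg (Submodule.fg_span (Set.finite_range y)) _
  have : FiniteDimensional k (powerSum V (s * m)) := Module.Finite.iff_fg.2 hfg
  -- Bounding each of the `s` exponents by `m` gives `(m + 1) ^ s` monomials of degree at most `s *
  -- m`.
  let e : (Fin s → Fin (m + 1)) → (Fin s →₀ ℕ) := fun a =>
    Finsupp.equivFunOnFinite.symm fun i => (a i : ℕ)
  have he : Function.Injective e := by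
    intro a b hab
    funext i
    have := DFunLike.congr_fun hab i
    exact Fin.ext this
  have hli := (linearIndependent_prod_pow hy).comp e he
  have hmem : ∀ a, ((fun a : Fin s →₀ ℕ => ∏ i, y i ^ a i) ∘ e) a ∈ powerSum V (s * m) := by
    intro a
    refine pow_le_powerSum V ?_ (prod_pow_mem_pow_sum
      (fun i => Submodule.subset_span (Set.mem_range_self i)) (e a) Finset.univ)
    calc ∑ i, e a i ≤ ∑ i : Fin s, m := Finset.sum_le_sum fun i _ => Nat.lt_succ_iff.1 (a i).2
      _ = s * m := by simp
  have hli' : LinearIndependent k fun a => (⟨_, hmem a⟩ : powerSum V (s * m)) :=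
    LinearIndependent.of_comp (powerSum V (s * m)).subtype hli
  simpa using hli'.fintype_card_le_finrank

theorem tendsto_const_add_div_log (a b : ℝ) :
    Tendsto (fun n : ℕ => ((a + b / Real.log n : ℝ) : EReal)) atTop (𝓝 (a : EReal)) := by
  refine (continuous_coe_real_ereal.tendsto a).comp ?_
  have h : Tendsto (fun n : ℕ => b / Real.log n) atTop (𝓝 0) :=
    tendsto_const_nhds.div_atTop (Real.tendsto_log_atTop.comp tendsto_natCast_atTop_atTop)
  simpa using h.const_add a

theorem le_gkDim_of_algebraicIndependent {k A : Type*} [Field k] [CommRing A] [Algebra k A] {s : ℕ}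
    {y : Fin s → A} (hy : AlgebraicIndependent k y) : (s : EReal) ≤ gkDim k A := by
  have hfg : (Submodule.span k (Set.range y)).FG := Submodule.fg_span (Set.finite_range y)
  refine le_trans ?_ (le_iSup _ ⟨Submodule.span k (Set.range y), Module.Finite.iff_fg.2 hfg⟩)
  -- The growth is at least `(n / s) ^ s`, with logarithm `s * log n - s * log s`.
  have hlim := tendsto_const_add_div_log s (-(s * Real.log s))
  have : ((s : ℝ) : EReal) = (s : EReal) := by simp
  rw [← this, ← hlim.limsup_eq]
  refine limsup_le_limsup ?_
  filter_upwards [eventually_ge_atTop (s + 2)] with n hn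
  rw [EReal.coe_le_coe_iff]
  have hn1 : (1 : ℝ) < n := by exact_mod_cast (by omega : 1 < n)
  have hlog : 0 < Real.log n := Real.log_pos hn1
  rw [← sub_nonneg, show Real.log (Module.finrank k (powerSum (Submodule.span k (Set.range y)) n))
    / Real.log n - (s + -(s * Real.log s) / Real.log n) = (Real.log (Module.finrank k
      (powerSum (Submodule.span k (Set.range y)) n)) - s * (Real.log n - Real.log s)) / Real.log n by
      field_simp; ring]
  refine div_nonneg (sub_nonneg.2 ?_) hlog.le
  have : FiniteDimensional k (powerSum (Submodule.span k (Set.range y)) n) :=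
    Module.Finite.iff_fg.2 (powerSum_fg hfg n)
  have h1 : (n / s + 1) ^ s ≤ Module.finrank k (powerSum (Submodule.span k (Set.range y)) n) :=
    (pow_le_finrank_powerSum hy (n / s)).trans
      (Submodule.finrank_mono (powerSum_mono _ (Nat.mul_div_le n s)))
  rcases Nat.eq_zero_or_pos s with rfl | hs
  · simp
    exact Real.log_natCast_nonneg _
  have hs' : (0 : ℝ) < s := by exact_mod_cast hs
  rw [← Real.log_div (by positivity) (by positivity), ← Real.log_pow]
  refine Real.log_le_log (by positivity) ?_
  refine le_trans (pow_le_pow_left₀ (by positivity) ?_ s)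
    (show ((n / s + 1 : ℕ) : ℝ) ^ s ≤ _ by exact_mod_cast h1)
  rw [div_le_iff₀ hs']
  have : n ≤ (n / s + 1) * s := by
    have := Nat.div_add_mod n s
    have := Nat.mod_lt n hs
    nlinarith
  exact_mod_cast this

theorem gkDim_le_of_eventually_le {k A : Type*} [Field k] [CommRing A] [Algebra k A] (r : ℕ)
    (h : ∀ V : Submodule k A, FiniteDimensional k V → ∃ C : ℝ,
      ∀ᶠ n : ℕ in atTop, (Module.finrank k (powerSum V n) : ℝ) ≤ C * (n : ℝ) ^ r) :
    gkDim k A ≤ r := by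
  refine iSup_le fun V => ?_
  obtain ⟨C, hC⟩ := h V.1 V.2
  -- The constant is raised to at least `1` so that the bound has nonnegative logarithm, which
  -- covers rank `0`, where `Real.log 0 = 0`.
  have hlim := tendsto_const_add_div_log r (Real.log (max C 1))
  have : ((r : ℝ) : EReal) = (r : EReal) := by simp
  rw [← this, ← hlim.limsup_eq]
  refine limsup_le_limsup ?_
  filter_upwards [hC, eventually_ge_atTop 2] with n hn hn2
  rw [EReal.coe_le_coe_iff]
  have hn1 : (1 : ℝ) < n := by exact_mod_cast hn2
  have hlog : 0 < Real.log n := Real.log_pos hn1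
  have hC1 : (0 : ℝ) < max C 1 := lt_max_of_lt_right one_pos
  rw [div_le_iff₀ hlog, add_mul, div_mul_cancel₀ _ hlog.ne', ← Real.log_pow, add_comm,
    ← Real.log_mul hC1.ne' (by positivity)]
  rcases Nat.eq_zero_or_pos (Module.finrank k (powerSum V.1 n)) with h0 | h0
  · rw [h0, Nat.cast_zero, Real.log_zero]
    refine Real.log_nonneg ?_
    exact one_le_mul_of_one_le_of_one_le (le_max_right _ _) (one_le_pow₀ hn1.le)
  · refine Real.log_le_log (by exact_mod_cast h0) (hn.trans ?_)
    gcongr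
    exact le_max_left _ _

/-! ### Abelian theorem for the Poincaré series -/

/-- Allows `n ^ r` to be replaced by binomial weights, whose generating series is exactly `1 / (1 -
t) ^ (r + 1)`. -/
theorem tendsto_choose_div_pow (r : ℕ) :
    Tendsto (fun n : ℕ => ((n + r).choose r : ℝ) / (n : ℝ) ^ r) atTop (𝓝 (1 / r.factorial)) := by
  induction r with
  | zero => simp
  | succ r ih =>
    have h1 : Tendsto (fun n : ℕ => (n + (r + 1) : ℝ) / n) atTop (𝓝 1) := by
      have := (tendsto_const_div_atTop_nhds_zero_nat (r + 1 : ℝ)).const_add 1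
      rw [add_zero] at this
      refine this.congr' ?_
      filter_upwards [eventually_ge_atTop 1] with n hn
      have : (n : ℝ) ≠ 0 := by positivity
      field_simp
    have h2 := (ih.mul h1).div_const (r + 1 : ℝ)
    rw [show (1 : ℝ) / (r + 1).factorial = 1 / r.factorial * 1 / (r + 1) by
      rw [Nat.factorial_succ]; push_cast; field_simp]
    refine h2.congr fun n => ?_
    have h3 : ((n + r + 1 : ℕ) : ℝ) * ((n + r).choose r : ℝ)
        = ((n + r + 1).choose (r + 1) : ℝ) * (r + 1 : ℝ) := by
      exact_mod_cast Nat.add_one_mul_choose_eq (n + r) r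
    rw [← add_assoc n r 1]
    rw [eq_div_iff (by positivity : (r + 1 : ℝ) ≠ 0) |>.2 h3.symm]
    push_cast
    ring

theorem summable_mul_pow_of_tendsto {u : ℕ → ℝ} {r : ℕ} {c : ℝ}
    (hu : Tendsto (fun n : ℕ => u n / (n : ℝ) ^ r) atTop (𝓝 c)) {t : ℝ} (h0 : 0 ≤ t) (h1 : t < 1) :
    Summable fun n => u n * t ^ n := by
  have hs : Summable fun n : ℕ => (n : ℝ) ^ r * t ^ n :=
    summable_pow_mul_geometric_of_norm_lt_one r (by rwa [Real.norm_of_nonneg h0])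
  refine summable_of_isBigO_nat hs (Asymptotics.IsBigO.mul ?_ (Asymptotics.isBigO_refl _ _))
  refine Asymptotics.isBigO_of_div_tendsto_nhds ?_ c hu
  filter_upwards [eventually_ge_atTop 1] with n hn h
  exact absurd h (by positivity)

/-- Abel's theorem for the weights `choose (n + r) r`. -/
theorem tendsto_one_sub_pow_mul_tsum {u : ℕ → ℝ} {r : ℕ} {c : ℝ}
    (hu : Tendsto (fun n : ℕ => u n / (n : ℝ) ^ r) atTop (𝓝 c)) :
    Tendsto (fun t : ℝ => (1 - t) ^ (r + 1) * ∑' n, u n * t ^ n) (𝓝[<] 1)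
      (𝓝 (c * r.factorial)) := by
  set b : ℕ → ℝ := fun n => ((n + r).choose r : ℝ) with hb
  set L := c * r.factorial with hL
  have hbpos : ∀ n, 0 < b n := fun n => by
    simp only [hb]
    exact_mod_cast Nat.choose_pos (Nat.le_add_left r n)
  have hub : Tendsto (fun n => u n / b n) atTop (𝓝 L) := by
    have := hu.div (tendsto_choose_div_pow r) (by positivity)
    rw [div_div_eq_mul_div, div_one] at this
    refine this.congr' ?_
    filter_upwards [eventually_ge_atTop 1] with n hn
    exact div_div_div_cancel_right₀ (by positivity) _ _
  have hB : ∀ t : ℝ, 0 ≤ t → t < 1 → HasSum (fun n => b n * t ^ n) (1 / (1 - t) ^ (r + 1)) :=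
    fun t h0 h1 => hasSum_choose_mul_geometric_of_norm_lt_one r (by rwa [Real.norm_of_nonneg h0])
  rw [Metric.tendsto_nhds]
  intro ε hε
  obtain ⟨N, hN⟩ := eventually_atTop.1 ((Metric.tendsto_nhds.1 hub) (ε / 2) (half_pos hε))
  -- The error `v` is at most `ε / 2 * b n` from `N` on; `w` carries the finitely many earlier
  -- terms. Their sum is at most `K` uniformly in `t`, and the factor `(1 - t) ^ (r + 1)` kills it.
  set v : ℕ → ℝ := fun n => u n - L * b n with hv
  set w : ℕ → ℝ := fun n => if n < N then |v n| else 0 with hw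
  have hvw : ∀ n, |v n| ≤ w n + ε / 2 * b n := by
    intro n
    by_cases hn : n < N
    · simp only [hw, if_pos hn]
      have := mul_pos (half_pos hε) (hbpos n)
      linarith
    · simp only [hw, if_neg hn, zero_add]
      have := hN n (not_lt.1 hn)
      rw [Real.dist_eq] at this
      have h2 : v n = (u n / b n - L) * b n := by
        simp only [hv]; rw [sub_mul, div_mul_cancel₀ _ (hbpos n).ne']
      rw [h2, abs_mul, abs_of_pos (hbpos n)]
      exact mul_le_mul_of_nonneg_right this.le (hbpos n).le
  set K := ∑ n ∈ Finset.range N, |v n| with hK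
  have hlim : Tendsto (fun t : ℝ => K * (1 - t) ^ (r + 1) + ε / 2) (𝓝[<] 1) (𝓝 (ε / 2)) := by
    have : Continuous fun t : ℝ => K * (1 - t) ^ (r + 1) + ε / 2 := by fun_prop
    have := (this.tendsto 1).mono_left (nhdsWithin_le_nhds (s := Set.Iio (1 : ℝ)))
    simpa using this
  filter_upwards [hlim.eventually (gt_mem_nhds (half_lt_self hε)),
    Ioo_mem_nhdsLT (zero_lt_one' ℝ)] with t ht ht01
  obtain ⟨h0, h1⟩ := ht01
  have h1t : 0 < 1 - t := sub_pos.2 h1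
  have hsu := summable_mul_pow_of_tendsto hu h0.le h1
  have hsb := hB t h0.le h1
  have hsv : HasSum (fun n => v n * t ^ n) ((∑' n, u n * t ^ n) - L * (1 / (1 - t) ^ (r + 1))) := by
    convert! hsu.hasSum.sub (hsb.mul_left L) using 2 with n
    simp only [hv]; ring
  have hsw : HasSum (fun n => w n * t ^ n) (∑ n ∈ Finset.range N, w n * t ^ n) :=
    hasSum_sum_of_ne_finset_zero fun n hn => by
      simp only [hw, if_neg (fun h => hn (Finset.mem_range.2 h)), zero_mul]
  have hbound : |(∑' n, u n * t ^ n) - L * (1 / (1 - t) ^ (r + 1))|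
      ≤ (∑ n ∈ Finset.range N, w n * t ^ n) + ε / 2 * (1 / (1 - t) ^ (r + 1)) := by
    rw [← hsv.tsum_eq, ← Real.norm_eq_abs]
    refine tsum_of_norm_bounded (hsw.add (hsb.mul_left (ε / 2))) fun n => ?_
    rw [Real.norm_eq_abs, abs_mul, abs_of_nonneg (pow_nonneg h0.le n), ← mul_assoc, ← add_mul]
    exact mul_le_mul_of_nonneg_right (hvw n) (pow_nonneg h0.le n)
  have hwK : (∑ n ∈ Finset.range N, w n * t ^ n) ≤ K := by
    refine Finset.sum_le_sum fun n hn => ?_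
    simp only [hw, if_pos (Finset.mem_range.1 hn)]
    exact mul_le_of_le_one_right (abs_nonneg _) (pow_le_one₀ h0.le h1.le)
  have hp : 0 < (1 - t) ^ (r + 1) := pow_pos h1t _
  rw [Real.dist_eq]
  have heq : (1 - t) ^ (r + 1) * (∑' n, u n * t ^ n) - L
      = (1 - t) ^ (r + 1) * ((∑' n, u n * t ^ n) - L * (1 / (1 - t) ^ (r + 1))) := by
    field_simp
  rw [heq, abs_mul, abs_of_pos hp]
  calc (1 - t) ^ (r + 1) * |(∑' n, u n * t ^ n) - L * (1 / (1 - t) ^ (r + 1))|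
      ≤ (1 - t) ^ (r + 1) * (K + ε / 2 * (1 / (1 - t) ^ (r + 1))) :=
        mul_le_mul_of_nonneg_left (hbound.trans (by linarith)) hp.le
    _ = K * (1 - t) ^ (r + 1) + ε / 2 := by field_simp
    _ < ε := ht

section Cumulative

variable {a : ℕ → ℝ} {r : ℕ} {c : ℝ}

theorem summable_mul_pow_of_tendsto_sum (ha : ∀ n, 0 ≤ a n)
    (h : Tendsto (fun n : ℕ => (∑ i ∈ Finset.range (n + 1), a i) / (n : ℝ) ^ r) atTop (𝓝 c))
    {t : ℝ} (h0 : 0 ≤ t) (h1 : t < 1) : Summable fun n => a n * t ^ n := by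
  refine Summable.of_nonneg_of_le (fun n => mul_nonneg (ha n) (pow_nonneg h0 n)) (fun n => ?_)
    (summable_mul_pow_of_tendsto h h0 h1)
  refine mul_le_mul_of_nonneg_right ?_ (pow_nonneg h0 n)
  exact Finset.single_le_sum (f := a) (fun i _ => ha i) (Finset.self_mem_range_succ n)

/-- Multiplication by `1 - t` undoes partial summation; it lowers the exponent `r + 1` of the
Abelian theorem to `r`. -/
theorem one_sub_mul_tsum_sum (ha : ∀ n, 0 ≤ a n)
    (h : Tendsto (fun n : ℕ => (∑ i ∈ Finset.range (n + 1), a i) / (n : ℝ) ^ r) atTop (𝓝 c))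
    {t : ℝ} (h0 : 0 ≤ t) (h1 : t < 1) :
    (1 - t) * ∑' n, (∑ i ∈ Finset.range (n + 1), a i) * t ^ n = ∑' n, a n * t ^ n := by
  have hs := summable_mul_pow_of_tendsto h h0 h1
  have hs' := summable_mul_pow_of_tendsto_sum ha h h0 h1
  have e1 : ∑' n, (∑ i ∈ Finset.range (n + 1), a i) * t ^ n = a 0 +
      (t * (∑' n, (∑ i ∈ Finset.range (n + 1), a i) * t ^ n) + ∑' n, a (n + 1) * t ^ (n + 1)) := by
    rw [← tsum_mul_left, ← (hs.mul_left t).tsum_add ((summable_nat_add_iff 1).2 hs'),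
      hs.tsum_eq_zero_add]
    congr 1
    · simp
    · refine tsum_congr fun n => ?_
      rw [Finset.sum_range_succ _ (n + 1)]
      ring
  have e2 := hs'.tsum_eq_zero_add
  rw [pow_zero, mul_one] at e2
  rw [e2]
  linarith

theorem tendsto_one_sub_pow_mul_tsum_of_sum (ha : ∀ n, 0 ≤ a n)
    (h : Tendsto (fun n : ℕ => (∑ i ∈ Finset.range (n + 1), a i) / (n : ℝ) ^ r) atTop (𝓝 c)) :
    Tendsto (fun t : ℝ => (1 - t) ^ r * ∑' n, a n * t ^ n) (𝓝[<] 1) (𝓝 (c * r.factorial)) := by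
  refine (tendsto_one_sub_pow_mul_tsum h).congr' ?_
  filter_upwards [Ioo_mem_nhdsLT (zero_lt_one' ℝ)] with t ht
  rw [← one_sub_mul_tsum_sum ha h ht.1.le ht.2]
  ring

/-- A finite limit for some `d < r` would, after multiplication by `(1 - t) ^ (r - d)`, force limit
`0` at exponent `r`, where it is `c * r! > 0`. -/
theorem exists_tendsto_one_sub_pow_mul_tsum_iff (ha : ∀ n, 0 ≤ a n) (hc : 0 < c)
    (h : Tendsto (fun n : ℕ => (∑ i ∈ Finset.range (n + 1), a i) / (n : ℝ) ^ r) atTop (𝓝 c))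
    (d : ℕ) :
    (∃ L : ℝ, Tendsto (fun t : ℝ => (1 - t) ^ d * ∑' n, a n * t ^ n) (𝓝[<] 1) (𝓝 L)) ↔ r ≤ d := by
  have hlim := tendsto_one_sub_pow_mul_tsum_of_sum ha h
  have hpow : ∀ e : ℕ, Tendsto (fun t : ℝ => (1 - t) ^ e) (𝓝[<] 1) (𝓝 (0 ^ e)) := by
    intro e
    have hc : Continuous fun t : ℝ => (1 - t) ^ e := by fun_prop
    simpa using (hc.tendsto 1).mono_left (nhdsWithin_le_nhds (s := Set.Iio (1 : ℝ)))
  constructor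
  · rintro ⟨L, hL⟩
    by_contra hd
    have hd' : r - d ≠ 0 := by omega
    have h2 := (hpow (r - d)).mul hL
    rw [zero_pow hd', zero_mul] at h2
    have h3 := tendsto_nhds_unique hlim (h2.congr fun t => by
      rw [← mul_assoc, ← pow_add]; congr 2; omega)
    have : 0 < c * r.factorial := by positivity
    exact this.ne' h3
  · intro hd
    refine ⟨_, ((hpow (d - r)).mul hlim).congr fun t => ?_⟩
    rw [← mul_assoc, ← pow_add]; congr 2; omega

theorem one_le_radius_ofScalars_of_tendsto_sum (ha : ∀ n, 0 ≤ a n)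
    (h : Tendsto (fun n : ℕ => (∑ i ∈ Finset.range (n + 1), a i) / (n : ℝ) ^ r) atTop (𝓝 c)) :
    1 ≤ (FormalMultilinearSeries.ofScalars ℝ a).radius := by
  refine ENNReal.le_of_forall_nnreal_lt fun t ht => ?_
  refine FormalMultilinearSeries.le_radius_of_summable _ ?_
  have := summable_mul_pow_of_tendsto_sum ha h t.2 (by exact_mod_cast ht)
  refine this.congr fun n => ?_
  rw [FormalMultilinearSeries.ofScalars_norm, Real.norm_of_nonneg (ha n)]
  rfl

end Cumulative

/-! ### Counting elements of a monoid in a lattice -/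

section LatticeCount

open MeasureTheory

variable {E : Type*} [NormedAddCommGroup E] [NormedSpace ℝ E]

/-- The group generated by `M` consists of differences of elements of `M`; a negative multiple swaps
the two terms. -/
theorem exists_mem_sub_of_mem_span_int {G : Type*} [AddCommGroup G] (M : AddSubmonoid G) {z : G}
    (hz : z ∈ Submodule.span ℤ (M : Set G)) : ∃ b ∈ M, b + z ∈ M := by
  induction hz using Submodule.span_induction with
  | mem x hx => exact ⟨0, M.zero_mem, by simpa using hx⟩
  | zero => exact ⟨0, M.zero_mem, by simp⟩
  | add x y _ _ hx hy =>
    obtain ⟨b, hb, hbx⟩ := hx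
    obtain ⟨b', hb', hby⟩ := hy
    exact ⟨b + b', M.add_mem hb hb', by rw [add_add_add_comm]; exact M.add_mem hbx hby⟩
  | smul n x _ hx =>
    obtain ⟨b, hb, hbx⟩ := hx
    obtain ⟨m, rfl | rfl⟩ := n.eq_nat_or_neg
    · refine ⟨m • b, M.nsmul_mem hb m, ?_⟩
      rw [natCast_zsmul, ← nsmul_add]
      exact M.nsmul_mem hbx m
    · refine ⟨m • (b + x), M.nsmul_mem hbx m, ?_⟩
      rw [neg_smul, natCast_zsmul, nsmul_add, add_neg_cancel_right]
      exact M.nsmul_mem hb m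

theorem finite_inter_lattice [FiniteDimensional ℝ E] (L : Submodule ℤ E) [DiscreteTopology L]
    {s : Set E} (hs : Bornology.IsBounded s) : (s ∩ (L : Set E)).Finite := by
  have : ProperSpace E := FiniteDimensional.proper ℝ E
  have : DiscreteTopology L.toAddSubgroup := inferInstanceAs (DiscreteTopology L)
  exact Metric.finite_isBounded_inter_isClosed DiscreteTopology.isDiscrete hs
    (AddSubgroup.isClosed_of_discrete (H := L.toAddSubgroup))

/-- Conductor: a translate of the lattice points in a finitely generated subcone lies in `M`. -/
theorem exists_conductor [FiniteDimensional ℝ E] (M : AddSubmonoid E)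
    [DiscreteTopology (Submodule.span ℤ (M : Set E))] (v : ℕ → E) (hv : ∀ i, v i ∈ M) (j : ℕ) :
    ∃ x ∈ M, ∀ l : ℕ → ℝ, (∀ i, 0 ≤ l i) →
      ∑ i ∈ Finset.range j, l i • v i ∈ Submodule.span ℤ (M : Set E) →
      x + ∑ i ∈ Finset.range j, l i • v i ∈ M := by
  classical
  set L := Submodule.span ℤ (M : Set E) with hL
  set s : Set E := Metric.closedBall 0 (∑ i ∈ Finset.range j, ‖v i‖) with hs
  have hfin : (s ∩ (L : Set E)).Finite := finite_inter_lattice L Metric.isBounded_closedBall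
  have hb : ∀ z : E, ∃ b ∈ M, z ∈ L → b + z ∈ M := by
    intro z
    by_cases hz : z ∈ L
    · obtain ⟨b, hb, h⟩ := exists_mem_sub_of_mem_span_int M hz
      exact ⟨b, hb, fun _ => h⟩
    · exact ⟨0, M.zero_mem, fun h => absurd h hz⟩
  choose b hbM hb using hb
  -- Splitting each coefficient into integer and fractional part leaves a remainder `z` among the
  -- finitely many lattice points of `s`. Summing `b` over all of them gives one translation that
  -- works for every `z`.
  refine ⟨∑ z ∈ hfin.toFinset, b z, M.sum_mem fun z _ => hbM z, fun l hl hy => ?_⟩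
  set z := ∑ i ∈ Finset.range j, Int.fract (l i) • v i with hz
  set w := ∑ i ∈ Finset.range j, ⌊l i⌋₊ • v i with hw
  have hwM : w ∈ M := M.sum_mem fun i _ => M.nsmul_mem (hv i) _
  have hsum : ∑ i ∈ Finset.range j, l i • v i = z + w := by
    rw [hz, hw, ← Finset.sum_add_distrib]
    refine Finset.sum_congr rfl fun i _ => ?_
    rw [← Nat.cast_smul_eq_nsmul ℝ, ← add_smul, natCast_floor_eq_intCast_floor (hl i),
      Int.fract_add_floor]
  have hzL : z ∈ L := by
    rw [hsum] at hy
    exact (Submodule.add_mem_iff_left _ (Submodule.subset_span hwM)).1 hy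
  have hzs : z ∈ s := by
    rw [hs, mem_closedBall_zero_iff]
    refine (norm_sum_le _ _).trans (Finset.sum_le_sum fun i _ => ?_)
    rw [norm_smul, Real.norm_of_nonneg (Int.fract_nonneg _)]
    exact mul_le_of_le_one_left (norm_nonneg _) (Int.fract_lt_one _).le
  have hmem : z ∈ hfin.toFinset := hfin.mem_toFinset.2 ⟨hzs, hzL⟩
  rw [hsum, ← Finset.add_sum_erase _ _ hmem]
  have : b z + ∑ x ∈ hfin.toFinset.erase z, b x + (z + w)
      = (b z + z) + ((∑ x ∈ hfin.toFinset.erase z, b x) + w) := by abel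
  rw [this]
  exact M.add_mem (hb z hzL) (M.add_mem (M.sum_mem fun x _ => hbM x) hwM)

/-- The convex hull of `0` and of the first `j` vectors of a sequence, each scaled to degree `1`. -/
def scaledHull (deg : E →ₗ[ℝ] ℝ) (v : ℕ → E) (j : ℕ) : Set E :=
  convexHull ℝ (insert 0 ((fun i => (deg (v i))⁻¹ • v i) '' Set.Iio j))

theorem scaledHull_mono (deg : E →ₗ[ℝ] ℝ) (v : ℕ → E) : Monotone (scaledHull deg v) := by
  intro i j hij
  exact convexHull_mono (Set.insert_subset_insert (Set.image_mono (Set.Iio_subset_Iio hij)))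

theorem isCompact_scaledHull (deg : E →ₗ[ℝ] ℝ) (v : ℕ → E) (j : ℕ) :
    IsCompact (scaledHull deg v j) :=
  (((Set.finite_Iio j).image _).insert 0).isCompact_convexHull ℝ

theorem convex_iUnion_scaledHull (deg : E →ₗ[ℝ] ℝ) (v : ℕ → E) :
    Convex ℝ (⋃ j, scaledHull deg v j) :=
  (scaledHull_mono deg v).directed_le.convex_iUnion fun _ => convex_convexHull ℝ _

theorem zero_mem_scaledHull (deg : E →ₗ[ℝ] ℝ) (v : ℕ → E) (j : ℕ) : 0 ∈ scaledHull deg v j :=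
  subset_convexHull ℝ _ (Set.mem_insert _ _)

theorem smul_mem_iUnion_scaledHull (deg : E →ₗ[ℝ] ℝ) (v : ℕ → E) (i : ℕ) :
    (deg (v i))⁻¹ • v i ∈ ⋃ j, scaledHull deg v j :=
  Set.mem_iUnion.2 ⟨i + 1, subset_convexHull ℝ _
    (Set.mem_insert_of_mem _ ⟨i, Nat.lt_succ_self i, rfl⟩)⟩

theorem scaledHull_subset_closedBall {deg : E →ₗ[ℝ] ℝ} {v : ℕ → E}
    (hdeg : ∀ i, ‖v i‖ ≤ deg (v i)) (j : ℕ) : scaledHull deg v j ⊆ Metric.closedBall 0 1 := by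
  refine convexHull_min (Set.insert_subset (by simp) ?_) (convex_closedBall _ _)
  rintro _ ⟨i, _, rfl⟩
  have h0 : 0 ≤ deg (v i) := (norm_nonneg _).trans (hdeg i)
  rw [mem_closedBall_zero_iff, norm_smul, norm_inv, Real.norm_of_nonneg h0]
  exact inv_mul_le_one_of_le₀ (hdeg i) h0

/-- The points with both properties form a convex set containing the generators. The coefficients
feed `exists_conductor`; the degree bound controls the translate. -/
theorem exists_sum_of_mem_scaledHull {deg : E →ₗ[ℝ] ℝ} {v : ℕ → E}
    (hdeg : ∀ i, ‖v i‖ ≤ deg (v i)) {j : ℕ} {x : E} (hx : x ∈ scaledHull deg v j) :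
    deg x ≤ 1 ∧ ∃ l : ℕ → ℝ, (∀ i, 0 ≤ l i) ∧ x = ∑ i ∈ Finset.range j, l i • v i := by
  let C : Set E := {x | deg x ≤ 1 ∧ ∃ l : ℕ → ℝ, (∀ i, 0 ≤ l i) ∧
    x = ∑ i ∈ Finset.range j, l i • v i}
  have h0 : ∀ i, 0 ≤ deg (v i) := fun i => (norm_nonneg _).trans (hdeg i)
  have hC : Convex ℝ C := by
    rintro x ⟨hx, l, hl, rfl⟩ y ⟨hy, l', hl', rfl⟩ a b ha hb hab
    refine ⟨?_, fun i => a * l i + b * l' i, fun i => ?_, ?_⟩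
    · rw [map_add, map_smul, map_smul, smul_eq_mul, smul_eq_mul]
      nlinarith
    · exact add_nonneg (mul_nonneg ha (hl i)) (mul_nonneg hb (hl' i))
    · rw [Finset.smul_sum, Finset.smul_sum, ← Finset.sum_add_distrib]
      refine Finset.sum_congr rfl fun i _ => ?_
      rw [add_smul, mul_smul, mul_smul]
  refine convexHull_min (Set.insert_subset ?_ ?_) hC hx
  · exact ⟨by simp, fun _ => 0, fun _ => le_rfl, by simp⟩
  · rintro _ ⟨i, hi, rfl⟩
    refine ⟨?_, fun i' => if i' = i then (deg (v i))⁻¹ else 0, fun i' => ?_, ?_⟩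
    · rw [map_smul, smul_eq_mul]
      exact inv_mul_le_one_of_le₀ le_rfl (h0 i)
    · dsimp only
      split_ifs
      exacts [inv_nonneg.2 (h0 i), le_rfl]
    · dsimp only
      rw [Finset.sum_eq_single_of_mem i (Finset.mem_range.2 hi)
        (fun b _ hb => by rw [if_neg hb, zero_smul]), if_pos rfl]

variable [FiniteDimensional ℝ E] (M : AddSubmonoid E)
  [DiscreteTopology (Submodule.span ℤ (M : Set E))] (deg : E →ₗ[ℝ] ℝ)

theorem finite_setOf_mem_deg_le (hdeg : ∀ x ∈ M, ‖x‖ ≤ deg x) (d : ℝ) :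
    {x | x ∈ M ∧ deg x ≤ d}.Finite := by
  refine (finite_inter_lattice (Submodule.span ℤ (M : Set E))
    (Metric.isBounded_closedBall (x := 0) (r := d))).subset ?_
  rintro x ⟨hx, hxd⟩
  exact ⟨by simpa using (hdeg x hx).trans hxd, Submodule.subset_span hx⟩

open scoped Pointwise in
theorem finite_inter_inv_smul_lattice {s : Set E} (hs : Bornology.IsBounded s) (L : Submodule ℤ E)
    [DiscreteTopology L] {n : ℕ} (hn : n ≠ 0) : (s ∩ (n : ℝ)⁻¹ • (L : Set E)).Finite := by
  have h := finite_inter_lattice L (hs.smul₀ (n : ℝ))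
  refine (h.image fun x => (n : ℝ)⁻¹ • x).subset ?_
  rintro _ ⟨hx, y, hy, rfl⟩
  have hn' : (n : ℝ) ≠ 0 := by exact_mod_cast hn
  refine ⟨y, ⟨⟨_, hx, ?_⟩, hy⟩, rfl⟩
  simp only
  rw [smul_inv_smul₀ hn']

open scoped Pointwise in
-- Upper bound of the count: for `x ≠ 0`, `x / n` is `deg x / n ≤ 1` times the normalised vector,
-- hence in the convex union, which contains `0`.
theorem ncard_deg_le_le_ncard_scaledHull {v : ℕ → E} (hv : ∀ i, v i ∈ M)
    (hsurj : ∀ x ∈ M, ∃ i, v i = x) (hdeg : ∀ x ∈ M, ‖x‖ ≤ deg x) {n : ℕ} (hn : n ≠ 0) :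
    {x | x ∈ M ∧ deg x ≤ n}.ncard ≤
      ((⋃ j, scaledHull deg v j) ∩ (n : ℝ)⁻¹ • (Submodule.span ℤ (M : Set E) : Set E)).ncard := by
  have hn' : (n : ℝ) ≠ 0 := by exact_mod_cast hn
  have hnpos : (0 : ℝ) < n := by positivity
  have hbdd : Bornology.IsBounded (⋃ j, scaledHull deg v j) :=
    Metric.isBounded_closedBall.subset
      (Set.iUnion_subset fun j => scaledHull_subset_closedBall (fun i => hdeg _ (hv i)) j)
  refine Set.ncard_le_ncard_of_injOn (fun x => (n : ℝ)⁻¹ • x) ?_ ?_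
    (finite_inter_inv_smul_lattice hbdd _ hn)
  · rintro x ⟨hx, hxn⟩
    refine ⟨?_, x, Submodule.subset_span hx, rfl⟩
    obtain ⟨i, rfl⟩ := hsurj x hx
    have h0 : 0 ≤ deg (v i) := (norm_nonneg _).trans (hdeg _ hx)
    rcases h0.eq_or_lt with h | h
    · have : v i = 0 := norm_le_zero_iff.1 ((hdeg _ hx).trans h.symm.le)
      simp only [this, smul_zero]
      exact Set.mem_iUnion.2 ⟨0, zero_mem_scaledHull deg v 0⟩
    · have hK := convex_iUnion_scaledHull deg v
      have h1 := hK.smul_mem_of_zero_mem (Set.mem_iUnion.2 ⟨0, zero_mem_scaledHull deg v 0⟩)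
        (smul_mem_iUnion_scaledHull deg v i) (t := (n : ℝ)⁻¹ * deg (v i))
        ⟨by positivity, by rw [inv_mul_le_iff₀ hnpos, mul_one]; exact hxn⟩
      rwa [smul_smul, mul_assoc, mul_inv_cancel₀ h.ne', mul_one] at h1
  · intro x _ y _ hxy
    exact smul_right_injective E (inv_ne_zero hn') hxy

open scoped Pointwise in
-- Lower bound of the count: `y ↦ x + n • y` lands in `M` for the conductor `x`, and `D` absorbs the
-- degree of `x`.
theorem exists_ncard_scaledHull_le {v : ℕ → E} (hv : ∀ i, v i ∈ M)
    (hdeg : ∀ x ∈ M, ‖x‖ ≤ deg x) (j : ℕ) : ∃ D : ℕ, ∀ n : ℕ, n ≠ 0 →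
      (scaledHull deg v j ∩ (n : ℝ)⁻¹ • (Submodule.span ℤ (M : Set E) : Set E)).ncard ≤
      {x | x ∈ M ∧ deg x ≤ (n + D : ℕ)}.ncard := by
  obtain ⟨x, hxM, hx⟩ := exists_conductor M v hv j
  refine ⟨⌈deg x⌉₊, fun n hn => ?_⟩
  have hn' : (n : ℝ) ≠ 0 := by exact_mod_cast hn
  refine Set.ncard_le_ncard_of_injOn (fun y => x + (n : ℝ) • y) ?_ ?_
    (finite_setOf_mem_deg_le M deg hdeg _)
  · rintro _ ⟨hyK, y, hy, rfl⟩
    obtain ⟨h1, l, hl, hyl⟩ := exists_sum_of_mem_scaledHull (fun i => hdeg _ (hv i)) hyK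
    simp only at hyl h1 ⊢
    constructor
    · have h2 : (n : ℝ) • (n : ℝ)⁻¹ • y = ∑ i ∈ Finset.range j, ((n : ℝ) * l i) • v i := by
        rw [hyl, Finset.smul_sum]
        simp only [smul_smul]
      rw [h2]
      refine hx _ (fun i => mul_nonneg (Nat.cast_nonneg n) (hl i)) ?_
      rw [← h2, smul_inv_smul₀ hn']
      exact hy
    · rw [map_add, map_smul, smul_eq_mul, Nat.cast_add, add_comm]
      exact add_le_add (mul_le_of_le_one_right (Nat.cast_nonneg n) h1) (Nat.le_ceil _)
  · intro y _ z _ hyz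
    exact smul_right_injective E hn' (add_left_cancel hyz)

/-- The number of elements of degree at most `n` in a submonoid of a lattice of rank `r` is
asymptotic to a positive multiple of `n ^ r`. -/
theorem exists_tendsto_ncard_deg_le [IsZLattice ℝ (Submodule.span ℤ (M : Set E))]
    (hdeg : ∀ x ∈ M, ‖x‖ ≤ deg x) :
    ∃ c : ℝ, 0 < c ∧ Tendsto (fun n : ℕ => ({x | x ∈ M ∧ deg x ≤ n}.ncard : ℝ) /
      (n : ℝ) ^ Module.finrank ℝ E) atTop (𝓝 c) := by
  set L := Submodule.span ℤ (M : Set E) with hL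
  borelize E
  have : Module.Finite ℤ L := ZLattice.module_finite ℝ L
  have : Module.Free ℤ L := ZLattice.module_free ℝ L
  let b := Module.Free.chooseBasis ℤ L
  have hr : Module.finrank ℝ E = Fintype.card (Module.Free.ChooseBasisIndex ℤ L) := by
    rw [← ZLattice.rank ℝ L, Module.finrank_eq_card_chooseBasisIndex]
  have : Countable M := by
    have : Countable L := inferInstance
    exact (Set.inclusion_injective (Submodule.subset_span : (M : Set E) ⊆ L)).countable
  obtain ⟨e, he⟩ := exists_surjective_nat M
  let v : ℕ → E := fun i => (e i : E)
  have hv : ∀ i, v i ∈ M := fun i => (e i).2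
  have hsurj : ∀ x ∈ M, ∃ i, v i = x := fun x hx => by
    obtain ⟨i, hi⟩ := he ⟨x, hx⟩
    exact ⟨i, congrArg Subtype.val hi⟩
  -- In these coordinates the lattice is `ℤ ^ r`, so point counts are governed by the volume of the
  -- image. Convexity makes the frontier null, as the counting theorem requires.
  let φ := (b.ofZLatticeBasis ℝ).equivFun
  have hφc : Continuous φ := φ.toLinearMap.continuous_of_finiteDimensional
  have hφsc : Continuous φ.symm := φ.symm.toLinearMap.continuous_of_finiteDimensional
  let K : ℕ → Set E := scaledHull deg v
  have hball : (⋃ j, K j) ⊆ Metric.closedBall 0 1 :=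
    Set.iUnion_subset fun j => scaledHull_subset_closedBall (fun i => hdeg _ (hv i)) j
  have hbdd : Bornology.IsBounded (⋃ j, K j) := Metric.isBounded_closedBall.subset hball
  have hmeas : MeasurableSet (⋃ j, K j) :=
    MeasurableSet.iUnion fun j => (isCompact_scaledHull deg v j).measurableSet
  have hfront : ∀ {s : Set E}, Convex ℝ s → volume (frontier (φ '' s)) = 0 := fun hs =>
    (hs.linear_image φ.toLinearMap).addHaar_frontier volume
  have hupper := ZLattice.covolume.tendsto_card_div_pow'' b hbdd hmeas
    (hfront (convex_iUnion_scaledHull deg v))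
  have hlower := fun j => ZLattice.covolume.tendsto_card_div_pow'' b
    (isCompact_scaledHull deg v j).isBounded (isCompact_scaledHull deg v j).measurableSet
    (hfront (convex_convexHull ℝ _))
  have hfinite : volume (φ '' ⋃ j, K j) ≠ ⊤ := by
    have : ProperSpace E := FiniteDimensional.proper ℝ E
    refine ne_top_of_le_ne_top ?_ (measure_mono (Set.image_mono hball))
    exact ((isCompact_closedBall (0 : E) 1).image hφc).measure_lt_top.ne
  have hvol : Tendsto (fun j => volume.real (φ '' K j)) atTop (𝓝 (volume.real (φ '' ⋃ j, K j))) := by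
    refine (ENNReal.tendsto_toReal hfinite).comp ?_
    rw [Set.image_iUnion]
    exact tendsto_measure_iUnion_atTop fun i j hij => Set.image_mono (scaledHull_mono deg v hij)
  have hpos : 0 < volume.real (φ '' ⋃ j, K j) := by
    refine ENNReal.toReal_pos (ne_of_gt ?_) hfinite
    have hzero : (0 : E) ∈ ⋃ j, K j := Set.mem_iUnion.2 ⟨0, zero_mem_scaledHull deg v 0⟩
    -- A convex set that contains `0` and spans `E` has nonempty interior, hence positive volume.
    have hspan : Submodule.span ℝ (⋃ j, K j) = ⊤ := by
      rw [eq_top_iff, ← IsZLattice.span_top (K := ℝ) (L := L), hL, Submodule.span_span_of_tower,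
        Submodule.span_le]
      intro x hx
      obtain ⟨i, rfl⟩ := hsurj x hx
      have h0 : 0 ≤ deg (v i) := (norm_nonneg _).trans (hdeg _ hx)
      rcases h0.eq_or_lt with h | h
      · have : v i = 0 := norm_le_zero_iff.1 ((hdeg _ hx).trans h.symm.le)
        rw [this]
        exact zero_mem _
      · have h1 := Submodule.smul_mem _ (deg (v i))
          (Submodule.subset_span (R := ℝ) (smul_mem_iUnion_scaledHull deg v i))
        rwa [smul_inv_smul₀ h.ne'] at h1
    have hint : (interior (⋃ j, K j)).Nonempty := by
      rw [(convex_iUnion_scaledHull deg v).interior_nonempty_iff_affineSpan_eq_top,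
        ← Set.insert_eq_of_mem hzero]
      refine SetLike.coe_injective ?_
      rw [affineSpan_insert_zero, hspan]
      rfl
    have hopen : IsOpen (φ '' interior (⋃ j, K j)) := by
      rw [LinearEquiv.image_eq_preimage_symm]
      exact isOpen_interior.preimage hφsc
    exact (hopen.measure_pos volume (hint.image _)).trans_le
      (measure_mono (Set.image_mono interior_subset))
  refine ⟨_, hpos, ?_⟩
  rw [hr]
  rw [tendsto_order]
  constructor
  -- Some polytope `K j` already has volume above `a`; the degree shift `D` costs only a factor
  -- tending to `1`.
  · intro a ha
    obtain ⟨j, hj⟩ := (hvol.eventually (lt_mem_nhds ha)).exists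
    obtain ⟨D, hD⟩ := exists_ncard_scaledHull_le M deg hv hdeg j
    set r := Fintype.card (Module.Free.ChooseBasisIndex ℤ L)
    have h1 : Tendsto (fun n : ℕ => ((n : ℝ) / ((n + D : ℕ) : ℝ)) ^ r) atTop (𝓝 1) := by
      have := (tendsto_natCast_div_add_atTop (𝕜 := ℝ) (D : ℝ)).pow r
      simpa using this
    have h2 := (hlower j).mul h1
    rw [mul_one] at h2
    have h3 : ∀ᶠ n : ℕ in atTop, a < ({x | x ∈ M ∧ deg x ≤ (n + D : ℕ)}.ncard : ℝ) /
        ((n + D : ℕ) : ℝ) ^ r := by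
      filter_upwards [h2.eventually (lt_mem_nhds hj), eventually_ge_atTop 1] with n hn hn1
      refine hn.trans_le ?_
      have hn0 : (n : ℝ) ≠ 0 := by positivity
      have hnD : (0 : ℝ) < ((n + D : ℕ) : ℝ) := by positivity
      rw [div_pow, div_mul_div_cancel₀ (pow_ne_zero _ hn0)]
      refine div_le_div_of_nonneg_right ?_ (pow_pos hnD r).le
      exact_mod_cast hD n (by omega)
    rw [← map_add_atTop_eq_nat D, eventually_map]
    exact h3
  · intro a ha
    filter_upwards [hupper.eventually (gt_mem_nhds ha), eventually_ge_atTop 1] with n hn hn1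
    refine lt_of_le_of_lt (div_le_div_of_nonneg_right ?_ (by positivity)) hn
    exact_mod_cast ncard_deg_le_le_ncard_scaledHull M deg hv hsurj hdeg (by omega)

end LatticeCount

/-! ### Exponent vectors as a lattice in their real span -/

section ExponentVectors

variable {n : ℕ}

/-- An exponent vector, viewed as a real vector. -/
noncomputable def realExponent (n : ℕ) : (Fin n →₀ ℕ) →+ (Fin n → ℝ) where
  toFun a i := a i
  map_zero' := by ext; simp
  map_add' a b := by ext; simp

@[simp]
theorem realExponent_apply (a : Fin n →₀ ℕ) (i : Fin n) : realExponent n a i = a i := rfl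

theorem realExponent_injective : Function.Injective (realExponent n) := by
  intro a b h
  ext i
  have := congrFun h i
  rw [realExponent_apply, realExponent_apply] at this
  exact_mod_cast this

/-- The real vector space spanned by a set of exponent vectors. -/
noncomputable def exponentSpan (M : AddSubmonoid (Fin n →₀ ℕ)) : Submodule ℝ (Fin n → ℝ) :=
  Submodule.span ℝ (realExponent n '' M)

/-- A monoid of exponent vectors, viewed inside the real vector space that it spans. -/
noncomputable def realMonoid (M : AddSubmonoid (Fin n →₀ ℕ)) : AddSubmonoid (exponentSpan M) :=
  (M.map (realExponent n)).comap (exponentSpan M).subtype.toAddMonoidHom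

theorem mem_realMonoid {M : AddSubmonoid (Fin n →₀ ℕ)} {x : exponentSpan M} :
    x ∈ realMonoid M ↔ ∃ a ∈ M, realExponent n a = x := Iff.rfl

instance discreteTopology_span_realMonoid (M : AddSubmonoid (Fin n →₀ ℕ)) :
    DiscreteTopology (Submodule.span ℤ (realMonoid M : Set (exponentSpan M))) := by
  set L₀ : Submodule ℤ (Fin n → ℝ) := Submodule.span ℤ (Set.range (Pi.basisFun ℝ (Fin n)))
  have hmem : ∀ x ∈ Submodule.span ℤ (realMonoid M : Set (exponentSpan M)),
      (x : Fin n → ℝ) ∈ L₀ := by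
    intro x hx
    induction hx using Submodule.span_induction with
    | mem x hx =>
      obtain ⟨a, _, ha⟩ := hx
      change realExponent n a = (x : Fin n → ℝ) at ha
      rw [← ha, Module.Basis.mem_span_iff_repr_mem]
      intro i
      exact ⟨a i, by simp⟩
    | zero => exact zero_mem _
    | add x y _ _ hx hy => exact add_mem hx hy
    | smul m x _ hx => exact L₀.smul_mem m hx
  let f : Submodule.span ℤ (realMonoid M : Set (exponentSpan M)) → L₀ :=
    fun x => ⟨x.1, hmem x.1 x.2⟩
  refine DiscreteTopology.of_continuous_injective (f := f) ?_ ?_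
  · exact (continuous_subtype_val.comp continuous_subtype_val).subtype_mk _
  · intro x y hxy
    have h : (f x).1 = (f y).1 := congrArg _ hxy
    exact Subtype.ext (Subtype.ext h)

instance isZLattice_span_realMonoid (M : AddSubmonoid (Fin n →₀ ℕ)) :
    IsZLattice ℝ (Submodule.span ℤ (realMonoid M : Set (exponentSpan M))) where
  span_top := by
    rw [Submodule.span_span_of_tower]
    exact Submodule.span_span_coe_preimage

/-- The total degree as a linear functional. -/
noncomputable def degreeFunctional (M : AddSubmonoid (Fin n →₀ ℕ)) : exponentSpan M →ₗ[ℝ] ℝ :=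
  (∑ i, LinearMap.proj i) ∘ₗ (exponentSpan M).subtype

theorem degreeFunctional_eq {M : AddSubmonoid (Fin n →₀ ℕ)} {x : exponentSpan M}
    {a : Fin n →₀ ℕ} (h : realExponent n a = x) : degreeFunctional M x = a.degree := by
  simp [degreeFunctional, ← h, Finsupp.degree_eq_sum]

/-- The norm is the sup norm, and coordinates of exponent vectors are nonnegative. -/
theorem norm_le_degreeFunctional {M : AddSubmonoid (Fin n →₀ ℕ)} {x : exponentSpan M}
    (hx : x ∈ realMonoid M) : ‖x‖ ≤ degreeFunctional M x := by
  obtain ⟨a, _, ha⟩ := mem_realMonoid.1 hx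
  rw [degreeFunctional_eq ha, Submodule.coe_norm, ← ha, pi_norm_le_iff_of_nonneg (by positivity)]
  intro i
  rw [realExponent_apply, Real.norm_natCast]
  exact_mod_cast Finsupp.le_degree i a

theorem finite_degree_le (n N : ℕ) : {a : Fin n →₀ ℕ | a.degree ≤ N}.Finite := by
  refine (Set.finite_Iic (Finsupp.equivFunOnFinite.symm fun _ : Fin n => N)).subset ?_
  intro a ha i
  exact (Finsupp.le_degree i a).trans ha

theorem ncard_degree_le (M : AddSubmonoid (Fin n →₀ ℕ)) (N : ℕ) :
    {x | x ∈ realMonoid M ∧ degreeFunctional M x ≤ N}.ncard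
      = {a | a ∈ M ∧ a.degree ≤ N}.ncard := by
  rw [← Set.ncard_image_of_injective _ realExponent_injective,
    ← Set.ncard_image_of_injective _ (Subtype.val_injective (p := (· ∈ exponentSpan M)))]
  congr 1
  ext y
  constructor
  · rintro ⟨x, ⟨hx, hxN⟩, rfl⟩
    obtain ⟨a, haM, ha⟩ := mem_realMonoid.1 hx
    rw [degreeFunctional_eq ha] at hxN
    exact ⟨a, ⟨haM, by exact_mod_cast hxN⟩, ha⟩
  · rintro ⟨a, ⟨haM, haN⟩, rfl⟩
    refine ⟨⟨realExponent n a, Submodule.subset_span ⟨a, haM, rfl⟩⟩, ⟨⟨a, haM, rfl⟩, ?_⟩, rfl⟩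
    rw [degreeFunctional_eq (a := a) rfl]
    exact_mod_cast haN

theorem exists_tendsto_ncard_degree_le (M : AddSubmonoid (Fin n →₀ ℕ)) :
    ∃ c : ℝ, 0 < c ∧ Tendsto (fun N : ℕ => ({a | a ∈ M ∧ a.degree ≤ N}.ncard : ℝ) /
      (N : ℝ) ^ Module.finrank ℝ (exponentSpan M)) atTop (𝓝 c) := by
  obtain ⟨c, hc, h⟩ := exists_tendsto_ncard_deg_le (realMonoid M) (degreeFunctional M)
    fun x hx => norm_le_degreeFunctional hx
  refine ⟨c, hc, h.congr fun N => ?_⟩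
  rw [ncard_degree_le]

theorem ncard_degree_le_eq_sum (M : AddSubmonoid (Fin n →₀ ℕ)) (N : ℕ) :
    {a | a ∈ M ∧ a.degree ≤ N}.ncard
      = ∑ i ∈ Finset.range (N + 1), {a | a ∈ M ∧ a.degree = i}.ncard := by
  classical
  have hfin : {a | a ∈ M ∧ a.degree ≤ N}.Finite := (finite_degree_le n N).subset fun a ha => ha.2
  rw [Set.ncard_eq_toFinset_card _ hfin, Finset.card_eq_sum_card_fiberwise
    (f := fun a : Fin n →₀ ℕ => a.degree) (t := Finset.range (N + 1))]
  · refine Finset.sum_congr rfl fun i hi => ?_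
    rw [← Set.ncard_coe_finset]
    congr 1
    ext a
    have := Finset.mem_range.1 hi
    simp only [Finset.coe_filter, Set.Finite.mem_toFinset, Set.mem_ofPred_eq]
    constructor
    · rintro ⟨⟨h1, _⟩, h3⟩
      exact ⟨h1, h3⟩
    · rintro ⟨h1, h3⟩
      exact ⟨⟨h1, by omega⟩, h3⟩
  · intro a ha
    have : a ∈ M ∧ a.degree ≤ N := by simpa using ha
    simpa using Nat.lt_succ_of_le this.2

theorem exists_linearIndependent_exponents (M : AddSubmonoid (Fin n →₀ ℕ)) :
    ∃ m : Fin (Module.finrank ℝ (exponentSpan M)) → (Fin n →₀ ℕ), (∀ i, m i ∈ M) ∧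
      LinearIndependent ℝ fun i => realExponent n (m i) := by
  rw [exponentSpan]
  obtain ⟨f, hf, _, hli⟩ := Submodule.exists_fun_fin_finrank_span_eq ℝ (realExponent n '' M)
  choose m hm hmf using hf
  refine ⟨m, hm, ?_⟩
  rw [show (fun i => realExponent n (m i)) = f from funext hmf]
  exact hli

end ExponentVectors

/-! ### Monomial algebras: grading, growth and independent monomials -/

section MonomialAlgebra

open MvPolynomial

variable {k : Type*} [Field k] {n : ℕ}

/-- Products of monomials are monomials, so the algebra is spanned by those with exponent in the
closure. This criterion is the hypothesis `hS` below. -/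
theorem mem_adjoin_monomial_iff (E : Set (Fin n →₀ ℕ)) (p : MvPolynomial (Fin n) k) :
    p ∈ Algebra.adjoin k ((fun e => monomial e (1 : k)) '' E) ↔
      (p.support : Set (Fin n →₀ ℕ)) ⊆ AddSubmonoid.closure E := by
  rw [← mem_restrictSupport_iff, restrictSupport_eq_span, ← Subalgebra.mem_toSubmodule,
    Algebra.adjoin_eq_span]
  suffices h : (Submonoid.closure ((fun e => monomial e (1 : k)) '' E) :
      Set (MvPolynomial (Fin n) k)) = (monomial · 1) '' (AddSubmonoid.closure E : Set _) by
    rw [h]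
  apply Set.Subset.antisymm
  · intro x hx
    induction hx using Submonoid.closure_induction with
    | mem x hx =>
      obtain ⟨e, he, rfl⟩ := hx
      exact ⟨e, AddSubmonoid.subset_closure he, rfl⟩
    | one => exact ⟨0, zero_mem _, rfl⟩
    | mul x y _ _ hx hy =>
      obtain ⟨a, ha, rfl⟩ := hx
      obtain ⟨b, hb, rfl⟩ := hy
      exact ⟨a + b, add_mem ha hb, by simp [monomial_mul]⟩
  · rintro _ ⟨a, ha, rfl⟩
    induction ha using AddSubmonoid.closure_induction with
    | mem e he => exact Submonoid.subset_closure ⟨e, he, rfl⟩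
    | zero => exact one_mem _
    | add a b _ _ ha hb =>
      have := mul_mem ha hb
      simpa [monomial_mul] using this

variable {S : Subalgebra k (MvPolynomial (Fin n) k)} {M : AddSubmonoid (Fin n →₀ ℕ)}

theorem monomial_mem_of_mem (hS : ∀ p, p ∈ S ↔ (p.support : Set (Fin n →₀ ℕ)) ⊆ M)
    {a : Fin n →₀ ℕ} (ha : a ∈ M) : monomial a (1 : k) ∈ S := by
  rw [hS]
  intro b hb
  have := support_monomial_subset hb
  rw [Finset.mem_singleton] at this
  rwa [this]

theorem map_comap_restrictSupport (hS : ∀ p, p ∈ S ↔ (p.support : Set (Fin n →₀ ℕ)) ⊆ M)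
    (s : Set (Fin n →₀ ℕ)) :
    ((restrictSupport k s).comap S.val.toLinearMap).map S.val.toLinearMap
      = restrictSupport k (M ∩ s) := by
  ext p
  rw [mem_restrictSupport_iff, Set.subset_inter_iff, ← hS]
  constructor
  · rintro ⟨q, hq, rfl⟩
    exact ⟨q.2, hq⟩
  · rintro ⟨hp, hps⟩
    exact ⟨⟨p, hp⟩, hps, rfl⟩

/-- The comparison of a component of `S` with the span of the monomials in it. -/
noncomputable def comapRestrictSupportEquiv (hS : ∀ p, p ∈ S ↔ (p.support : Set (Fin n →₀ ℕ)) ⊆ M)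
    (s : Set (Fin n →₀ ℕ)) :
    (restrictSupport k s).comap S.val.toLinearMap ≃ₗ[k] restrictSupport k (M ∩ s) :=
  (Submodule.equivMapOfInjective S.val.toLinearMap Subtype.val_injective _).trans
    (LinearEquiv.ofEq _ _ (map_comap_restrictSupport hS s))

/-- Serves both the graded pieces (`s` of fixed degree) and the degree filtration (`s` of bounded
degree). -/
theorem finrank_comap_restrictSupport (hS : ∀ p, p ∈ S ↔ (p.support : Set (Fin n →₀ ℕ)) ⊆ M)
    (s : Set (Fin n →₀ ℕ)) :
    Module.finrank k ((restrictSupport k s).comap S.val.toLinearMap)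
      = ((M : Set (Fin n →₀ ℕ)) ∩ s).ncard := by
  rw [(comapRestrictSupportEquiv hS s).finrank_eq,
    Module.finrank_eq_nat_card_basis (basisRestrictSupport k _)]
  rfl

theorem finite_comap_restrictSupport (hS : ∀ p, p ∈ S ↔ (p.support : Set (Fin n →₀ ℕ)) ⊆ M)
    {s : Set (Fin n →₀ ℕ)} (hs : s.Finite) :
    FiniteDimensional k ((restrictSupport k s).comap S.val.toLinearMap) := by
  have := (hs.subset (Set.inter_subset_right (s := (M : Set (Fin n →₀ ℕ))))).to_subtype
  have := Module.Finite.of_basis (basisRestrictSupport k ((M : Set (Fin n →₀ ℕ)) ∩ s))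
  exact Module.Finite.equiv (comapRestrictSupportEquiv hS s).symm

theorem homogeneousSubmodule_eq_restrictSupport (i : ℕ) :
    homogeneousSubmodule (Fin n) k i = restrictSupport k {a | a.degree = i} :=
  homogeneousSubmodule_eq_finsupp_supported _ _ _

theorem finrank_standardGrading (hS : ∀ p, p ∈ S ↔ (p.support : Set (Fin n →₀ ℕ)) ⊆ M) (i : ℕ) :
    Module.finrank k (standardGrading S i) = {a | a ∈ M ∧ a.degree = i}.ncard := by
  rw [standardGrading, homogeneousSubmodule_eq_restrictSupport, finrank_comap_restrictSupport hS]
  rfl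

theorem finite_standardGrading (hS : ∀ p, p ∈ S ↔ (p.support : Set (Fin n →₀ ℕ)) ⊆ M) (i : ℕ) :
    FiniteDimensional k (standardGrading S i) := by
  rw [standardGrading, homogeneousSubmodule_eq_restrictSupport]
  exact finite_comap_restrictSupport hS ((finite_degree_le n i).subset fun a ha => le_of_eq ha)

theorem gradedMonoid_standardGrading (S : Subalgebra k (MvPolynomial (Fin n) k)) :
    SetLike.GradedMonoid (standardGrading S) where
  one_mem := isHomogeneous_one (Fin n) k
  mul_mem _ _ _ _ hx hy := IsHomogeneous.mul hx hy

theorem standardGrading_zero (S : Subalgebra k (MvPolynomial (Fin n) k)) :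
    standardGrading S 0 = 1 := by
  ext x
  rw [standardGrading, homogeneousSubmodule_zero, Submodule.mem_comap, Submodule.mem_one,
    Submodule.mem_one]
  refine exists_congr fun a => ?_
  rw [Subtype.ext_iff]
  rfl

theorem isInternal_standardGrading
    (hS : ∀ p, p ∈ S ↔ (p.support : Set (Fin n →₀ ℕ)) ⊆ M) :
    DirectSum.IsInternal (standardGrading S) := by
  have hgr : iSupIndep (homogeneousSubmodule (Fin n) k) := by
    let := gradedAlgebra (σ := Fin n) (R := k)
    exact (DirectSum.Decomposition.isInternal
      (homogeneousSubmodule (Fin n) k)).submodule_iSupIndep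
  rw [DirectSum.isInternal_submodule_iff_iSupIndep_and_iSup_eq_top]
  constructor
  · rw [iSupIndep_def]
    intro i
    rw [Submodule.disjoint_def]
    intro x hx hx'
    refine Subtype.ext (Submodule.disjoint_def.1 (iSupIndep_def.1 hgr i) x.1 hx ?_)
    have hle : (⨆ j, ⨆ _ : j ≠ i, standardGrading S j) ≤
        (⨆ j, ⨆ _ : j ≠ i, homogeneousSubmodule (Fin n) k j).comap S.val.toLinearMap :=
      iSup₂_le fun j hj => Submodule.comap_mono (le_iSup₂_of_le j hj le_rfl)
    exact hle hx'
  · rw [eq_top_iff]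
    intro x _
    -- Taking a homogeneous component only shrinks the support.
    have hmem : ∀ i, homogeneousComponent i x.1 ∈ S := by
      intro i
      rw [hS]
      refine subset_trans ?_ ((hS _).1 x.2)
      intro a ha
      simp only [SetLike.mem_coe, mem_support_iff, coeff_homogeneousComponent] at ha ⊢
      exact fun h => ha (by simp [h])
    have hx : x = ∑ i ∈ Finset.range (x.1.totalDegree + 1),
        (⟨homogeneousComponent i x.1, hmem i⟩ : S) := by
      refine Subtype.ext ?_
      rw [AddSubmonoidClass.coe_finsetSum]
      exact (sum_homogeneousComponent x.1).symm
    rw [hx]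
    exact Submodule.sum_mem _ fun i _ => Submodule.mem_iSup_of_mem i
      (homogeneousComponent_isHomogeneous i x.1)

theorem powerSum_le_restrictTotalDegree {V : Submodule k S} {D : ℕ}
    (hV : V ≤ (restrictTotalDegree (Fin n) k D).comap S.val.toLinearMap) (N : ℕ) :
    powerSum V N ≤ (restrictTotalDegree (Fin n) k (D * N)).comap S.val.toLinearMap := by
  have hpow : ∀ i, V ^ i ≤ (restrictTotalDegree (Fin n) k (D * i)).comap S.val.toLinearMap := by
    intro i
    induction i with
    | zero =>
      rw [pow_zero, Submodule.one_le]
      simp [mem_restrictTotalDegree]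
    | succ i ih =>
      rw [pow_succ, Submodule.mul_le]
      intro x hx y hy
      have h1 := (mem_restrictTotalDegree _ _ _).1 (ih hx)
      have h2 := (mem_restrictTotalDegree _ _ _).1 (hV hy)
      refine (mem_restrictTotalDegree _ _ _).2 ((totalDegree_mul x.1 y.1).trans ?_)
      exact add_le_add h1 h2
  unfold powerSum
  refine Finset.sum_induction _ (· ≤ _) (fun a b ha hb => sup_le ha hb) bot_le fun i hi => ?_
  refine (hpow i).trans (Submodule.comap_mono fun p hp => ?_)
  rw [mem_restrictTotalDegree] at hp ⊢
  exact hp.trans (Nat.mul_le_mul_left D (Nat.lt_succ_iff.1 (Finset.mem_range.1 hi)))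

theorem exists_le_restrictTotalDegree {V : Submodule k S} (hV : V.FG) :
    ∃ D : ℕ, V ≤ (restrictTotalDegree (Fin n) k D).comap S.val.toLinearMap := by
  obtain ⟨t, rfl⟩ := hV
  refine ⟨t.sup fun x => x.1.totalDegree, Submodule.span_le.2 fun x hx => ?_⟩
  exact (mem_restrictTotalDegree _ _ _).2 (Finset.le_sup (f := fun x : S => x.1.totalDegree) hx)

theorem exists_finrank_powerSum_le (hS : ∀ p, p ∈ S ↔ (p.support : Set (Fin n →₀ ℕ)) ⊆ M)
    {V : Submodule k S} (hV : V.FG) : ∃ D : ℕ, 0 < D ∧ ∀ N,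
      Module.finrank k (powerSum V N) ≤ {a | a ∈ M ∧ a.degree ≤ D * N}.ncard := by
  obtain ⟨D, hD⟩ := exists_le_restrictTotalDegree hV
  -- `D + 1` keeps the factor positive, so that `D * N` tends to infinity in the asymptotic
  -- estimate.
  refine ⟨D + 1, D.succ_pos, fun N => ?_⟩
  have hT : restrictTotalDegree (Fin n) k ((D + 1) * N)
      = restrictSupport k {a | a.degree ≤ (D + 1) * N} := rfl
  have hle := powerSum_le_restrictTotalDegree (D := D + 1) (hD.trans (Submodule.comap_mono
    fun p hp => by
      rw [mem_restrictTotalDegree] at hp ⊢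
      omega)) N
  rw [hT] at hle
  have := finite_comap_restrictSupport hS (finite_degree_le n ((D + 1) * N))
  exact (Submodule.finrank_mono hle).trans_eq (finrank_comap_restrictSupport hS _)

theorem exists_eventually_finrank_powerSum_le
    (hS : ∀ p, p ∈ S ↔ (p.support : Set (Fin n →₀ ℕ)) ⊆ M) {V : Submodule k S} (hV : V.FG) :
    ∃ C : ℝ, ∀ᶠ N : ℕ in atTop, (Module.finrank k (powerSum V N) : ℝ) ≤
      C * (N : ℝ) ^ Module.finrank ℝ (exponentSpan M) := by
  obtain ⟨D, hD, hle⟩ := exists_finrank_powerSum_le hS hV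
  obtain ⟨c, hc, hlim⟩ := exists_tendsto_ncard_degree_le M
  set r := Module.finrank ℝ (exponentSpan M)
  have hmul : Tendsto (fun N : ℕ => D * N) atTop atTop := tendsto_id.const_mul_atTop' hD
  refine ⟨(c + 1) * D ^ r, ?_⟩
  filter_upwards [(hlim.comp hmul).eventually (gt_mem_nhds (lt_add_one c)),
    eventually_ge_atTop 1] with N hN hN1
  simp only [Function.comp_apply] at hN
  rw [div_lt_iff₀ (by positivity)] at hN
  calc (Module.finrank k (powerSum V N) : ℝ)
      ≤ ({a | a ∈ M ∧ a.degree ≤ D * N}.ncard : ℝ) := by exact_mod_cast hle N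
    _ ≤ (c + 1) * ((D * N : ℕ) : ℝ) ^ r := hN.le
    _ = (c + 1) * D ^ r * (N : ℝ) ^ r := by push_cast; ring

/-- Independent elements are bounded through growth: `s ≤ GKdim ≤ r`. -/
theorem le_of_algebraicIndependent (hS : ∀ p, p ∈ S ↔ (p.support : Set (Fin n →₀ ℕ)) ⊆ M)
    (s : ℕ) (y : Fin s → S) (hy : AlgebraicIndependent k y) :
    s ≤ Module.finrank ℝ (exponentSpan M) := by
  have h1 := le_gkDim_of_algebraicIndependent hy
  have h2 : gkDim k S ≤ Module.finrank ℝ (exponentSpan M) :=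
    gkDim_le_of_eventually_le _ fun V hV =>
      exists_eventually_finrank_powerSum_le hS (Module.Finite.iff_fg.1 hV)
  exact_mod_cast h1.trans h2

/-- Monomials in the family have exponents `∑ i, a i • m i`, distinct for distinct `a`, so they are
linearly independent. -/
theorem algebraicIndependent_monomial {s : ℕ} {m : Fin s → (Fin n →₀ ℕ)}
    (hm : LinearIndependent ℝ fun i => realExponent n (m i)) :
    AlgebraicIndependent k fun i => monomial (m i) (1 : k) := by
  let e : (Fin s →₀ ℕ) → (Fin n →₀ ℕ) := fun a => ∑ i, a i • m i
  have he : Function.Injective e := by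
    intro a b hab
    have h1 : ∑ i, (a i : ℝ) • realExponent n (m i) = ∑ i, (b i : ℝ) • realExponent n (m i) := by
      simpa [e, map_sum, map_nsmul, Nat.cast_smul_eq_nsmul] using congrArg (realExponent n) hab
    have h2 := linearIndependent_iff_injective_fintypeLinearCombination.1 hm
      (a₁ := fun i => (a i : ℝ)) (a₂ := fun i => (b i : ℝ))
      (by simpa [Fintype.linearCombination_apply] using h1)
    ext i
    exact_mod_cast congrFun h2 i
  have hli := (basisMonomials (Fin n) k).linearIndependent.comp e he
  rw [LinearIndependent] at hli
  have hcomp : ∀ p : MvPolynomial (Fin s) k, aeval (fun i => monomial (m i) (1 : k)) p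
      = Finsupp.linearCombination k (⇑(basisMonomials (Fin n) k) ∘ e)
        ((basisMonomials (Fin s) k).repr p) := by
    intro p
    conv_lhs => rw [← (basisMonomials (Fin s) k).linearCombination_repr p]
    rw [← AlgHom.toLinearMap_apply, Finsupp.apply_linearCombination]
    congr 2
    funext a
    rw [Function.comp_apply, Function.comp_apply, coe_basisMonomials, coe_basisMonomials,
      AlgHom.toLinearMap_apply, aeval_monomial, map_one, one_mul,
      Finsupp.prod_fintype _ _ fun _ => pow_zero _]
    simp [monomial_pow, e, monomial_sum_one]
  intro p q hpq
  change aeval _ p = aeval _ q at hpq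
  rw [hcomp, hcomp] at hpq
  exact (basisMonomials (Fin s) k).repr.injective (hli hpq)

theorem exists_algebraicIndependent (hS : ∀ p, p ∈ S ↔ (p.support : Set (Fin n →₀ ℕ)) ⊆ M) :
    ∃ y : Fin (Module.finrank ℝ (exponentSpan M)) → S, AlgebraicIndependent k y := by
  obtain ⟨m, hmM, hm⟩ := exists_linearIndependent_exponents M
  refine ⟨fun i => ⟨monomial (m i) 1, monomial_mem_of_mem hS (hmM i)⟩, ?_⟩
  rw [← S.val.algebraicIndependent_iff Subtype.val_injective]
  exact algebraicIndependent_monomial hm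

end MonomialAlgebra

/-! ### A long chain of primes -/

section PrimeChain

open MvPolynomial

variable {k : Type*} [Field k] {n : ℕ}

/-- The monomial map from the polynomial ring to the group algebra of a quotient of the real
vector space of exponents. -/
noncomputable def toQuotientAlgebra (k : Type*) [Field k] {n : ℕ}
    (W : Submodule ℝ (Fin n → ℝ)) :
    MvPolynomial (Fin n) k →ₐ[k] AddMonoidAlgebra k ((Fin n → ℝ) ⧸ W) :=
  aeval fun i => AddMonoidAlgebra.single (W.mkQ (realExponent n (Finsupp.single i 1))) 1

theorem toQuotientAlgebra_monomial (W : Submodule ℝ (Fin n → ℝ)) (a : Fin n →₀ ℕ) :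
    toQuotientAlgebra k W (monomial a 1)
      = AddMonoidAlgebra.single (W.mkQ (realExponent n a)) 1 := by
  induction a using Finsupp.induction_linear with
  | zero =>
    rw [map_zero, map_zero, ← AddMonoidAlgebra.one_def]
    exact map_one _
  | add a b ha hb =>
    rw [show monomial (a + b) (1 : k) = monomial a 1 * monomial b 1 by simp [monomial_mul],
      map_mul, ha, hb, AddMonoidAlgebra.single_mul_single, map_add, map_add, one_mul]
  | single i c =>
    rw [← X_pow_eq_monomial, map_pow, toQuotientAlgebra, aeval_X,
      AddMonoidAlgebra.single_pow, one_pow, ← map_nsmul, ← map_nsmul]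
    simp

theorem toQuotientAlgebra_factor {W W' : Submodule ℝ (Fin n → ℝ)} (h : W ≤ W')
    {p : MvPolynomial (Fin n) k} (hp : toQuotientAlgebra k W p = 0) :
    toQuotientAlgebra k W' p = 0 := by
  have hcomp : (AddMonoidAlgebra.mapDomainAlgHom k k
      (Submodule.factor h).toAddMonoidHom).comp (toQuotientAlgebra k W)
      = toQuotientAlgebra k W' := by
    ext i
    simp [toQuotientAlgebra]
  rw [← hcomp, AlgHom.comp_apply, hp, map_zero]

/-- A `ℚ`-vector space has unique sums, which excludes zero divisors in its group algebra. -/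
theorem noZeroDivisors_quotientAlgebra (W : Submodule ℝ (Fin n → ℝ)) :
    NoZeroDivisors (AddMonoidAlgebra k ((Fin n → ℝ) ⧸ W)) := by
  have : Module ℚ ((Fin n → ℝ) ⧸ W) := Module.compHom _ (algebraMap ℚ ℝ)
  infer_instance

variable (S : Subalgebra k (MvPolynomial (Fin n) k))

/-- The prime of `S` obtained by identifying monomials whose exponents agree modulo `W`. -/
noncomputable def quotientPrime (W : Submodule ℝ (Fin n → ℝ)) : PrimeSpectrum S :=
  have := noZeroDivisors_quotientAlgebra (k := k) W
  ⟨RingHom.ker ((toQuotientAlgebra k W).comp S.val), RingHom.ker_isPrime _⟩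

theorem mem_quotientPrime {W : Submodule ℝ (Fin n → ℝ)} {x : S} :
    x ∈ (quotientPrime S W).asIdeal ↔ toQuotientAlgebra k W x.1 = 0 := Iff.rfl

/-- The element `x ^ a - 1` separates the primes: it lies in the one attached to `V` exactly when `a
∈ V`. -/
theorem quotientPrime_lt {W W' : Submodule ℝ (Fin n → ℝ)} (h : W ≤ W') {a : Fin n →₀ ℕ}
    (ha : monomial a (1 : k) ∈ S) (haW : realExponent n a ∉ W) (haW' : realExponent n a ∈ W') :
    quotientPrime S W < quotientPrime S W' := by
  have key : ∀ V : Submodule ℝ (Fin n → ℝ),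
      (⟨monomial a 1, ha⟩ - 1 : S) ∈ (quotientPrime S V).asIdeal ↔ realExponent n a ∈ V := by
    intro V
    rw [mem_quotientPrime, AddSubgroupClass.coe_sub, map_sub, sub_eq_zero,
      toQuotientAlgebra_monomial, OneMemClass.coe_one, map_one, AddMonoidAlgebra.one_def,
      ← Submodule.Quotient.mk_eq_zero, ← Submodule.mkQ_apply]
    exact ⟨fun h => AddMonoidAlgebra.single_left_injective one_ne_zero h, fun h => by rw [h]⟩
  rw [← PrimeSpectrum.asIdeal_lt_asIdeal]
  refine lt_of_le_of_ne (fun x hx => toQuotientAlgebra_factor h hx) fun heq => haW ?_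
  rw [← key, heq, key]
  exact haW'

/-- The spans of the first `j` exponent vectors, for `j` from `0` to `r`, give the chain;
independence makes each step strict. -/
theorem le_ringKrullDim_of_linearIndependent {r : ℕ} {m : Fin r → (Fin n →₀ ℕ)}
    (hm : LinearIndependent ℝ fun i => realExponent n (m i))
    (hmS : ∀ i, monomial (m i) (1 : k) ∈ S) : (r : WithBot ℕ∞) ≤ ringKrullDim S := by
  let W : ℕ → Submodule ℝ (Fin n → ℝ) := fun j =>
    Submodule.span ℝ ((fun i => realExponent n (m i)) '' {i : Fin r | i.1 < j})
  have hmono : StrictMono fun j : Fin (r + 1) => quotientPrime S (W j) := by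
    rw [Fin.strictMono_iff_lt_succ]
    intro i
    refine quotientPrime_lt S ?_ (hmS i) ?_ ?_
    · exact Submodule.span_mono (Set.image_mono fun j (hj : j.1 < i.1) =>
        show j.1 < i.1 + 1 by omega)
    · exact hm.notMem_span_image (s := {j : Fin r | j.1 < i.1})
        (by simp)
    · exact Submodule.subset_span ⟨i, show i.1 < i.1 + 1 by omega, rfl⟩
  exact Order.LTSeries.length_le_krullDim (LTSeries.mk r _ hmono)

end PrimeChain

/-! ### Assembly: all invariants equal the rank of the exponents -/

theorem theorem5p4 {k : Type*} [Field k] (n : ℕ)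
    (S : Subalgebra k (MvPolynomial (Fin n) k)) (hS : IsMonomialAlgebra S) :
    IsHilbertSerre (standardGrading S) ∧
      ringKrullDim S = (hilbertSerreDim (standardGrading S) : WithBot ℕ∞) ∧
      Algebra.trdeg k S = (hilbertSerreDim (standardGrading S) : Cardinal) ∧
      gkDim k S = (hilbertSerreDim (standardGrading S) : EReal) := by
  obtain ⟨E, rfl⟩ := hS
  set S := Algebra.adjoin k ((fun e => MvPolynomial.monomial e (1 : k)) '' E)
  set M := AddSubmonoid.closure E
  have hS : ∀ p, p ∈ S ↔ (p.support : Set (Fin n →₀ ℕ)) ⊆ M := mem_adjoin_monomial_iff E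
  obtain ⟨c, hc, hlim⟩ := exists_tendsto_ncard_degree_le M
  have hsum : Tendsto (fun N : ℕ => (∑ i ∈ Finset.range (N + 1),
      (Module.finrank k (standardGrading S i) : ℝ)) /
      (N : ℝ) ^ Module.finrank ℝ (exponentSpan M)) atTop (𝓝 c) := by
    refine hlim.congr fun N => ?_
    rw [ncard_degree_le_eq_sum, Nat.cast_sum]
    simp only [finrank_standardGrading hS]
  have hpole : poleBounds (standardGrading S) = Set.Ici (Module.finrank ℝ (exponentSpan M)) :=
    Set.ext fun d => exists_tendsto_one_sub_pow_mul_tsum_iff (fun i => Nat.cast_nonneg _) hc hsum d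
  have hdim : hilbertSerreDim (standardGrading S) = Module.finrank ℝ (exponentSpan M) := by
    rw [hilbertSerreDim, hpole, csInf_Ici]
  obtain ⟨y, hy⟩ := exists_algebraicIndependent hS
  obtain ⟨m, hmM, hm⟩ := exists_linearIndependent_exponents M
  have hle := le_of_algebraicIndependent hS
  rw [hdim]
  refine ⟨⟨inferInstance, gradedMonoid_standardGrading S, isInternal_standardGrading hS,
    standardGrading_zero S, finite_standardGrading hS, ?_, ?_⟩, le_antisymm ?_ ?_,
    le_antisymm ?_ ?_, le_antisymm ?_ ?_⟩
  · exact one_le_radius_ofScalars_of_tendsto_sum (fun i => Nat.cast_nonneg _) hsum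
  · rw [hpole]
    exact Set.nonempty_Ici
  · exact ringKrullDim_le_of_forall_algebraicIndependent k hle
  · exact le_ringKrullDim_of_linearIndependent S hm fun i => monomial_mem_of_mem hS (hmM i)
  · exact trdeg_le_of_forall_algebraicIndependent hle
  · exact le_trdeg_of_algebraicIndependent hy
  · exact gkDim_le_of_eventually_le _ fun V hV =>
      exists_eventually_finrank_powerSum_le hS (Module.Finite.iff_fg.1 hV)
  · exact le_gkDim_of_algebraicIndependent hy
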